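/- Let $K$ be a field of characteristic zero, let $V$ be a vector space over $K$, and let $\mathfrak{g}=(V,[\,,])$ and $\mathfrak{n}=(V,\{\,,\})$ be two Lie algebras over $K$ on the same vector space $V$, both isomorphic to the three-dimensional Heisenberg Lie algebra $\mathfrak{n}_3(K)$ (with basis $e_1,e_2,e_3$ and only nonzero brackets of basis vectors $[e_1,e_2]=e_3=-[e_2,e_1]$). Let $x\cdot y$ be a PA-structure (post-Lie algebra structure) on $(\mathfrak{g},\mathfrak{n})$, that is, a $K$-bilinear product on $V$ with $$x\cdot y-y\cdot x=[x,y]-\{x,y\},\qquad [x,y]\cdot z=x\cdot(y\cdot z)-y\cdot(x\cdot z),\qquad x\cdot\{y,z\}=\{x\cdot y,z\}+\{y,x\cdot z\}$$ for all $x,y,z\in V$. Then all left multiplication operators $L(x)\colon V\to V$, $y\mapsto x\cdot y$, are nilpotent, and for all $x,y,z\in V$ $$x\cdot\{y,z\}=0,\qquad [x,y]\cdot z=-z\cdot[x,y],\qquad [x,y\cdot z]+[x,z\cdot y]=[y,x\cdot z]+[y,z\cdot x].$$ Moreover $x\circ y=\tfrac12(x\cdot y+y\cdot x)$ is a CPA-structure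 (commutative post-Lie algebra structure) on $\mathfrak{g}$, that is, a $K$-bilinear product with $$x\circ y=y\circ x,\qquad [x,y]\circ z=x\circ(y\circ z)-y\circ(x\circ z),\qquad x\circ[y,z]=[x\circ y,z]+[y,x\circ z]$$ for all $x,y,z\in V$. -/

import Mathlib

/-- A Lie bracket on a vector space `V` over `K`: an alternating `K`-bilinear product satisfying
the Jacobi identity (in Leibniz form). It is a structure and not a type class because two
different Lie brackets on the same vector space have to be considered at once. -/
structure LieBracket (K V : Type*) [Field K] [AddCommGroup V] [Module K V] where
  br : V →ₗ[K] V →ₗ[K] V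
  br_self : ∀ x, br x x = 0
  jacobi : ∀ x y z, br x (br y z) = br (br x y) z + br y (br x z)

namespace LieBracket

variable {K V : Type*} [Field K] [AddCommGroup V] [Module K V]

/-- The Lie algebra `(V, b)`: a copy of the vector space `V` carrying the Lie bracket `b`. -/
def Alg (_b : LieBracket K V) : Type _ := V

instance (b : LieBracket K V) : AddCommGroup b.Alg := inferInstanceAs (AddCommGroup V)

instance (b : LieBracket K V) : Module K b.Alg := inferInstanceAs (Module K V)

instance (b : LieBracket K V) : LieRing b.Alg where
  bracket x y := b.br x y
  add_lie x y z := LinearMap.map_add₂ b.br x y z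
  lie_add x y z := map_add (b.br x) y z
  lie_self x := b.br_self x
  leibniz_lie x y z := b.jacobi x y z

instance (b : LieBracket K V) : LieAlgebra K b.Alg where
  lie_smul t x y := map_smul (b.br x) t y

end LieBracket

/-- The bracket of the three-dimensional Heisenberg Lie algebra on `K³`: in the standard basis
`e₁, e₂, e₃` it is given by `[e₁, e₂] = e₃ = -[e₂, e₁]`, all other brackets of basis vectors
being zero. -/
def heisenberg (K : Type*) [Field K] : LieBracket K (Fin 3 → K) where
  br := LinearMap.mk₂ K (fun x y => ![0, 0, x 0 * y 1 - x 1 * y 0])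
    (by intro x y z; ext i; fin_cases i <;> simp; ring)
    (by intro c x y; ext i; fin_cases i <;> simp; ring)
    (by intro x y z; ext i; fin_cases i <;> simp; ring)
    (by intro c x y; ext i; fin_cases i <;> simp; ring)
  br_self x := by ext i; fin_cases i <;> simp; ring
  jacobi x y z := by ext i; fin_cases i <;> simp

/-- `b.IsHeisenberg`: the Lie algebra `(V, b)` is isomorphic to the three-dimensional Heisenberg
Lie algebra over `K`. -/
def LieBracket.IsHeisenberg {K V : Type*} [Field K] [AddCommGroup V] [Module K V]
    (b : LieBracket K V) : Prop :=
  Nonempty (b.Alg ≃ₗ⁅K⁆ (heisenberg K).Alg)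

/-- The bilinear product `mul x y = x · y` is a post-Lie algebra structure (PA-structure) on the
pair `(g, n)` of Lie brackets `[ , ] = g.br` and `{ , } = n.br` on `V`. -/
structure IsPAStructure {K V : Type*} [Field K] [AddCommGroup V] [Module K V]
    (g n : LieBracket K V) (mul : V →ₗ[K] V →ₗ[K] V) : Prop where
  mul_sub_mul : ∀ x y, mul x y - mul y x = g.br x y - n.br x y
  br_mul : ∀ x y z, mul (g.br x y) z = mul x (mul y z) - mul y (mul x z)
  mul_br : ∀ x y z, mul x (n.br y z) = n.br (mul x y) z + n.br y (mul x z)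

/-- The bilinear product `mul x y = x · y` is a commutative post-Lie algebra structure
(CPA-structure) on the Lie algebra `(V, g)`. -/
structure IsCPAStructure {K V : Type*} [Field K] [AddCommGroup V] [Module K V]
    (g : LieBracket K V) (mul : V →ₗ[K] V →ₗ[K] V) : Prop where
  comm : ∀ x y, mul x y = mul y x
  br_mul : ∀ x y z, mul (g.br x y) z = mul x (mul y z) - mul y (mul x z)
  mul_br : ∀ x y z, mul x (g.br y z) = g.br (mul x y) z + g.br y (mul x z)

/-- The symmetrized product `x ∘ y = ½ (x · y + y · x)`, as a bilinear map. -/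
def symmProduct {K V : Type*} [Field K] [AddCommGroup V] [Module K V]
    (mul : V →ₗ[K] V →ₗ[K] V) : V →ₗ[K] V →ₗ[K] V :=
  (1 / 2 : K) • (mul + mul.flip)

/-! Each `L(x)` is a derivation of `n`, so it preserves the center `Kc` of `n`. The proof splits
according to the center `Kz` of `g`.

If the centers agree, then `g = r n` with `r ≠ 0`. The scalar `t(x)` by which `L(x)` acts on `c` is
multiplicative, and `t ≠ 0` would force `r = 0` (`mul_center_eq_zero`). Hence `L(x)` is skew for the
symplectic form that `n` induces on `V/Kc`, which with commutativity modulo `c` gives `L(x)² V ⊆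
Kc`.

If they differ, the axioms in a basis `c, z, e` leave only a two-parameter family
(`mul_table_of_centers_ne`), where the identities can be read off.

The CPA claim then follows formally from the identities and two-step nilpotency. -/

namespace LieBracket

variable {K V : Type*} [Field K] [AddCommGroup V] [Module K V]

/-! ### Heisenberg brackets in coordinates -/

theorem br_swap (b : LieBracket K V) (x y : V) : b.br x y = -b.br y x := by
  have h := b.br_self (x + y)
  simp only [map_add, LinearMap.add_apply, b.br_self, zero_add, add_zero] at h
  exact eq_neg_of_add_eq_zero_right h

/-- Vectors `u, v, c` together with the first two coordinate functionals `α, β`, exhibiting `b` as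
the Heisenberg bracket with `[u, v] = c`. -/
structure HeisenbergFrame (b : LieBracket K V) (u v c : V) (α β : V →ₗ[K] K) : Prop where
  br_eq : ∀ x y, b.br x y = (α x * β y - β x * α y) • c
  ne_zero : c ≠ 0
  α_u : α u = 1
  β_u : β u = 0
  α_v : α v = 0
  β_v : β v = 1
  α_c : α c = 0
  β_c : β c = 0
  exists_eq : ∀ x, ∃ γ : K, x = α x • u + β x • v + γ • c

theorem IsHeisenberg.exists_frame {b : LieBracket K V} (hb : b.IsHeisenberg) :
    ∃ (u v c : V) (α β : V →ₗ[K] K), b.HeisenbergFrame u v c α β := by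
  obtain ⟨φ⟩ := hb
  let f : V ≃ₗ[K] (Fin 3 → K) := φ.toLinearEquiv
  have hf : ∀ x y, f (b.br x y) = ![0, 0, f x 0 * f y 1 - f x 1 * f y 0] := fun x y =>
    φ.map_lie x y
  refine ⟨f.symm ![1, 0, 0], f.symm ![0, 1, 0], f.symm ![0, 0, 1],
    LinearMap.proj 0 ∘ₗ f.toLinearMap, LinearMap.proj 1 ∘ₗ f.toLinearMap, ?_⟩
  constructor
  · intro x y
    apply f.injective
    rw [hf, map_smul, f.apply_symm_apply]
    ext i
    fin_cases i <;> simp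
  · intro h
    have := congrArg (fun x => f x 2) h
    simp at this
  · simp
  · simp
  · simp
  · simp
  · simp
  · simp
  · intro x
    refine ⟨f x 2, f.injective ?_⟩
    simp only [map_add, map_smul, f.apply_symm_apply]
    ext i
    fin_cases i <;> simp

namespace HeisenbergFrame

variable {b : LieBracket K V} {u v c : V} {α β : V →ₗ[K] K}

theorem br_u_v (h : b.HeisenbergFrame u v c α β) : b.br u v = c := by
  simp [h.br_eq, h.α_u, h.β_u, h.α_v, h.β_v]

theorem br_center (h : b.HeisenbergFrame u v c α β) (x : V) : b.br x c = 0 := by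
  simp [h.br_eq, h.α_c, h.β_c]

theorem center_br (h : b.HeisenbergFrame u v c α β) (x : V) : b.br c x = 0 := by
  simp [h.br_eq, h.α_c, h.β_c]

theorem br_br (h : b.HeisenbergFrame u v c α β) (x y z : V) : b.br x (b.br y z) = 0 := by
  rw [h.br_eq y z, map_smul, h.br_center, smul_zero]

theorem eq_smul_center (h : b.HeisenbergFrame u v c α β) {x : V} (hα : α x = 0) (hβ : β x = 0) :
    ∃ γ : K, x = γ • c := by
  obtain ⟨γ, hγ⟩ := h.exists_eq x
  exact ⟨γ, by simpa [hα, hβ] using hγ⟩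

/-- Cramer's rule modulo `c`: the coordinates are pairings under the symplectic form on `V/Kc`. -/
theorem exists_coord (h : b.HeisenbergFrame u v c α β) {x e : V}
    (hxe : α x * β e - β x * α e = 1) (y : V) :
    ∃ γ : K, y = (α y * β e - β y * α e) • x + (α x * β y - β x * α y) • e + γ • c := by
  obtain ⟨γ, hγ⟩ := h.eq_smul_center
    (x := y - ((α y * β e - β y * α e) • x + (α x * β y - β x * α y) • e))
    (by simp only [map_sub, map_add, map_smul, smul_eq_mul]; linear_combination -α y * hxe)
    (by simp only [map_sub, map_add, map_smul, smul_eq_mul]; linear_combination -β y * hxe)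
  exact ⟨γ, by rw [← hγ]; abel⟩

end HeisenbergFrame

end LieBracket

/-! ### Action on the center, and symmetrization -/

namespace IsPAStructure

open LieBracket

variable {K V : Type*} [Field K] [AddCommGroup V] [Module K V]
  {g n : LieBracket K V} {mul : V →ₗ[K] V →ₗ[K] V} {u v c : V} {α β : V →ₗ[K] K}

/-- A derivation acts on `c = {u, v}` by its trace on `V/Kc`. -/
theorem mul_center (hmul : IsPAStructure g n mul) (hn : n.HeisenbergFrame u v c α β) (x : V) :
    mul x c = (α (mul x u) + β (mul x v)) • c := by
  have h := hmul.mul_br x u v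
  rw [hn.br_u_v] at h
  rw [h, hn.br_eq, hn.br_eq, hn.α_u, hn.β_u, hn.α_v, hn.β_v]
  module

/-- The symmetrization of a PA-structure is a CPA-structure under the given identities, when both
Lie brackets are two-step nilpotent. -/
theorem isCPAStructure_symmProduct [CharZero K] (hmul : IsPAStructure g n mul)
    (hg : ∀ x y z, g.br x (g.br y z) = 0) (hn : ∀ x y z, n.br x (n.br y z) = 0)
    (h₁ : ∀ x y z, mul x (n.br y z) = 0)
    (h₂ : ∀ x y z, mul (g.br x y) z = -mul z (g.br x y))
    (h₃ : ∀ x y z, g.br x (mul y z) + g.br x (mul z y) = g.br y (mul x z) + g.br y (mul z x)) :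
    IsCPAStructure g (symmProduct mul) := by
  have hs : ∀ x y, symmProduct mul x y = (1 / 2 : K) • (mul x y + mul y x) := fun x y => rfl
  have hd : ∀ x y, symmProduct mul x y = mul x y - (1 / 2 : K) • (g.br x y - n.br x y) := by
    intro x y
    rw [hs, ← hmul.mul_sub_mul]
    module
  have hnull : ∀ x y z, symmProduct mul (g.br x y) z = 0 := by
    intro x y z
    rw [hs, h₂]
    simp
  have hcomm : ∀ x y, symmProduct mul x y = symmProduct mul y x := by
    intro x y
    rw [hs, hs, add_comm]
  have hsymm : ∀ x y z, g.br x (symmProduct mul y z) = g.br y (symmProduct mul x z) := by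
    intro x y z
    rw [hs, hs, map_smul, map_smul, map_add, map_add, h₃]
  have hmg : ∀ x y z, mul x (g.br y z) = -(1 / 2 : K) • n.br x (g.br y z) := by
    intro x y z
    have h := hmul.mul_sub_mul x (g.br y z)
    rw [hg, h₂] at h
    linear_combination (norm := module) (1 / 2 : K) • h
  -- With `x·{y,z} = 0`, summing `br_mul` cyclically shows that this sum equals its own negative.
  have hcyc : ∀ x y z, mul x (g.br y z) + mul y (g.br z x) + mul z (g.br x y) = 0 := by
    intro x y z
    have e : ∀ x y z, mul x (mul y z) - mul x (mul z y) = mul x (g.br y z) := by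
      intro x y z
      rw [← map_sub, hmul.mul_sub_mul, map_sub, h₁, sub_zero]
    have b₁ := hmul.br_mul x y z
    have b₂ := hmul.br_mul y z x
    have b₃ := hmul.br_mul z x y
    rw [h₂] at b₁ b₂ b₃
    linear_combination (norm := module) (-(1 / 2) : K) • (b₁ + b₂ + b₃ + e x y z + e y z x + e z x y)
  have hnder : ∀ x y z, n.br x (mul z y) - n.br y (mul z x) = 0 := by
    intro x y z
    have h := hmul.mul_br z x y
    rw [h₁, n.br_swap (mul z x) y] at h
    linear_combination (norm := module) -h
  have hnsub : ∀ x y z, n.br x (mul y z) - n.br x (mul z y) = n.br x (g.br y z) := by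
    intro x y z
    rw [← map_sub, hmul.mul_sub_mul, map_sub, hn, sub_zero]
  refine ⟨hcomm, ?_, ?_⟩
  · intro x y z
    rw [hnull]
    have key : ∀ x y z, symmProduct mul x (symmProduct mul y z) =
        mul x (mul y z) - (1 / 2 : K) • mul x (g.br y z)
          - (1 / 2 : K) • g.br x (symmProduct mul y z)
          + (1 / 2 : K) • (n.br x (mul y z) - (1 / 2 : K) • n.br x (g.br y z)) := by
      intro x y z
      rw [hd x, hd y z]
      simp only [map_sub, map_smul, h₁, hn]
      module
    have hb := hmul.br_mul x y z
    rw [h₂] at hb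
    have hc := hcyc x y z
    rw [g.br_swap z x, map_neg] at hc
    rw [key x y z, key y x z, hsymm x y z]
    have m₁ := hmg x y z
    have m₂ := hmg y x z
    have d := hnder x y z
    have s₁ := hnsub x y z
    have s₂ := hnsub y x z
    linear_combination (norm := module) hb + hc - (1 / 2 : K) • (s₁ - s₂ + d) - (1 / 2 : K) • (m₁ - m₂)
  -- The left side vanishes by `hnull`; the right side cancels because `[x, y∘z]` is totally
  -- symmetric.
  · intro x y z
    rw [hcomm, hnull, g.br_swap (symmProduct mul x y) z, hsymm z x y, hcomm z y, hsymm x y z]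
    simp

/-! ### Equal centers -/

section SameCenter

variable {r : K}

theorem center_mul (hmul : IsPAStructure g n mul) (hn : n.HeisenbergFrame u v c α β)
    (hgn : ∀ x y, g.br x y = r • n.br x y) (x : V) :
    mul c x = (α (mul x u) + β (mul x v)) • c := by
  have h := hmul.mul_sub_mul x c
  rw [hgn, hn.br_center, hmul.mul_center hn] at h
  linear_combination (norm := module) -h

/-- If `g` is a nonzero multiple of the Heisenberg bracket `n`, left multiplications kill the
center. -/
theorem mul_center_eq_zero (hmul : IsPAStructure g n mul) (hn : n.HeisenbergFrame u v c α β)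
    (hr : r ≠ 0) (hgn : ∀ x y, g.br x y = r • n.br x y) (x : V) : mul x c = 0 := by
  have smul_inj : ∀ {a b : K}, a • c = b • c → a = b := fun h =>
    smul_left_injective K hn.ne_zero h
  obtain ⟨t, ht⟩ : ∃ t : V →ₗ[K] K, ∀ x, t x = α (mul x u) + β (mul x v) :=
    ⟨α ∘ₗ mul.flip u + β ∘ₗ mul.flip v, fun x => rfl⟩
  have hxc : ∀ x, mul x c = t x • c := fun x => by rw [ht, hmul.mul_center hn]
  have hcx : ∀ x, mul c x = t x • c := fun x => by rw [ht, hmul.center_mul hn hgn]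
  have htc : t c = 0 := by
    rw [ht, hcx, hcx]
    simp [hn.α_c, hn.β_c]
  have htmul : ∀ x y, t (mul x y) = t x * t y := by
    intro x y
    have h := hmul.br_mul x c y
    simp only [hgn, hn.br_center, hcx, map_smul, hxc, smul_zero, map_zero, LinearMap.zero_apply] at h
    apply smul_inj
    linear_combination (norm := module) h
  rw [hxc]
  by_contra hne
  have hx0 : t x ≠ 0 := fun h => hne (by rw [h, zero_smul])
  set e := (t x)⁻¹ • x with he
  have hte : t e = 1 := by rw [he, map_smul, smul_eq_mul, inv_mul_cancel₀ hx0]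
  -- Chosen so that pairing with `k` is `t`; thus `k` spans `ker t` modulo `c`, and `{e, k} = c`.
  set k := t u • v - t v • u with hk
  have hαk : α k = -t v := by simp [hk, hn.α_u, hn.α_v]
  have hβk : β k = t u := by simp [hk, hn.β_u, hn.β_v]
  have htk : t k = 0 := by
    simp only [hk, map_sub, map_smul, smul_eq_mul]
    ring
  have hyk : ∀ y, α y * β k - β y * α k = t y := by
    intro y
    obtain ⟨γ, hγ⟩ := hn.exists_eq y
    have h := congrArg t hγ
    simp only [map_add, map_smul, smul_eq_mul, htc] at h
    rw [hαk, hβk]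
    linear_combination -h
  have hek : α e * β k - β e * α k = 1 := by rw [hyk, hte]
  have coord := hn.exists_coord hek
  have der : ∀ x y z, t x * (α y * β z - β y * α z) =
      (α (mul x y) * β z - β (mul x y) * α z) + (α y * β (mul x z) - β y * α (mul x z)) := by
    intro x y z
    have h := hmul.mul_br x y z
    rw [hn.br_eq, hn.br_eq, hn.br_eq, map_smul, hxc] at h
    apply smul_inj
    linear_combination (norm := module) h
  have sub : ∀ x y, mul x y - mul y x = ((r - 1) * (α x * β y - β x * α y)) • c := by
    intro x y
    rw [hmul.mul_sub_mul, hgn, hn.br_eq]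
    module
  obtain ⟨b₁, hb₁⟩ := coord (mul e k)
  rw [hyk, htmul, htk, mul_zero, zero_smul, zero_add] at hb₁
  have ha₁ := der e e k
  rw [hyk, hte, hyk, htmul, hte] at ha₁
  have ha₁' : α e * β (mul e k) - β e * α (mul e k) = 0 := by linear_combination -ha₁
  rw [ha₁', zero_smul, zero_add] at hb₁
  have hb₂ : mul k e = (b₁ - (r - 1)) • c := by
    have h := sub e k
    rw [hek, hb₁] at h
    linear_combination (norm := module) -h
  obtain ⟨b₃, hb₃⟩ := coord (mul k k)
  rw [hyk, htmul, htk, mul_zero, zero_smul, zero_add] at hb₃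
  have ha₃ := der k e k
  rw [htk, hb₂] at ha₃
  simp only [map_smul, hn.α_c, hn.β_c, smul_zero, zero_mul, sub_zero, zero_add] at ha₃
  rw [← ha₃, zero_smul, zero_add] at hb₃
  have hgke : g.br k e = (-r) • c := by
    rw [hgn, hn.br_eq, smul_smul]
    congr 1
    linear_combination -r * hek
  have r₁ := hmul.br_mul k e k
  rw [hgke, map_smul, LinearMap.smul_apply, hcx, htk, hb₁, hb₃, map_smul, map_smul, hxc, hxc, htk,
    hte] at r₁
  have hb₃0 : b₃ = 0 := by
    apply smul_inj
    linear_combination (norm := module) r₁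
  obtain ⟨f, hf⟩ := coord (mul e e)
  rw [hyk, htmul, hte] at hf
  -- Here `[k,e]·e = -r c`, while `k·(e·e)` and `e·(k·e)` coincide, so `r = 0`.
  have r₂ := hmul.br_mul k e e
  rw [hgke, map_smul mul, LinearMap.smul_apply, hcx, hte, hf, hb₂] at r₂
  simp only [map_add, map_smul, hb₂, hb₃, hb₃0, hxc, htk, hte] at r₂
  apply hr
  apply smul_inj
  linear_combination (norm := module) -r₂

theorem nilpotent_and_identities_of_eq_smul [CharZero K] (hmul : IsPAStructure g n mul)
    (hn : n.HeisenbergFrame u v c α β) (hr : r ≠ 0) (hgn : ∀ x y, g.br x y = r • n.br x y) :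
    (∀ x, IsNilpotent (mul x : Module.End K V)) ∧
    (∀ x y z, mul x (n.br y z) = 0) ∧
    (∀ x y z, mul (g.br x y) z = -mul z (g.br x y)) ∧
    (∀ x y z, g.br x (mul y z) + g.br x (mul z y) = g.br y (mul x z) + g.br y (mul z x)) := by
  have hxc := hmul.mul_center_eq_zero hn hr hgn
  have hcx : ∀ x, mul c x = 0 := fun x => by
    rw [hmul.center_mul hn hgn, ← hmul.mul_center hn, hxc]
  have h₁ : ∀ x y z, mul x (n.br y z) = 0 := fun x y z => by
    rw [hn.br_eq, map_smul, hxc, smul_zero]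
  have hn₁ : ∀ x y z, mul (n.br x y) z = 0 := fun x y z => by
    rw [hn.br_eq, map_smul, LinearMap.smul_apply, hcx, smul_zero]
  have hcomm : ∀ x y, mul x y = mul y x + (r - 1) • n.br x y := by
    intro x y
    have h := hmul.mul_sub_mul x y
    rw [hgn] at h
    linear_combination (norm := module) h
  have hbr : ∀ x y z, n.br x (mul y z) = n.br x (mul z y) := fun x y z => by
    rw [hcomm y z, map_add, map_smul, hn.br_br, smul_zero, add_zero]
  have hskew : ∀ x y z, n.br (mul x y) z = -n.br y (mul x z) := fun x y z => by
    have h := hmul.mul_br x y z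
    rw [h₁] at h
    exact eq_neg_of_add_eq_zero_left h.symm
  refine ⟨fun x => ⟨3, ?_⟩, h₁, fun x y z => ?_, fun x y z => ?_⟩
  -- Modulo `c`, `L(x)²` agrees with `L(x·x)`, which is skew; but the square of a skew operator is
  -- self-adjoint. So `L(x)²` vanishes modulo `c`, and `L(x)` kills `c`.
  · have hsq : ∀ y z, n.br z (mul x (mul x y)) = n.br z (mul (mul x x) y) := by
      intro y z
      have h := hmul.br_mul x y x
      rw [hgn, map_smul, LinearMap.smul_apply, hn₁, smul_zero] at h
      rw [hbr z (mul x x) y, ← sub_eq_zero.mp h.symm, hcomm x y, map_add, map_smul, h₁, smul_zero,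
        add_zero]
    have hzero : ∀ y z, n.br z (mul x (mul x y)) = 0 := by
      intro y z
      have e₁ : n.br z (mul x (mul x y)) = n.br y (mul x (mul x z)) := by
        rw [hsq y z, hsq z y, n.br_swap y, hskew, neg_neg]
      have e₂ : n.br z (mul x (mul x y)) = -n.br y (mul x (mul x z)) := by
        rw [n.br_swap y, hskew, hskew, neg_neg, neg_neg]
      linear_combination (norm := module) (1 / 2 : K) • (e₁ + e₂)
    ext y
    have hu := hzero y u
    have hv := hzero y v
    rw [hn.br_eq, smul_eq_zero, or_iff_left hn.ne_zero] at hu hv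
    simp only [hn.α_u, hn.β_u, hn.α_v, hn.β_v, one_mul, zero_mul, sub_zero, zero_sub,
      neg_eq_zero] at hu hv
    obtain ⟨γ, hγ⟩ := hn.eq_smul_center hv hu
    change mul x (mul x (mul x y)) = 0
    rw [hγ, map_smul, hxc, smul_zero]
  · rw [hgn, map_smul, map_smul, LinearMap.smul_apply, hn₁, h₁, smul_zero, neg_zero]
  · have h : n.br x (mul z y) = n.br y (mul z x) := by
      rw [← neg_eq_iff_eq_neg.mpr (hskew z x y), n.br_swap, neg_neg]
    simp only [hgn]
    rw [hbr x y z, hbr y x z, h]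

end SameCenter

/-! ### Different centers -/

/-- A PA-structure on a pair of Heisenberg brackets with different centers is determined up to two
parameters in the basis `c, z, e` with `{z, e} = c` and `[c, e] = s z`. -/
theorem mul_table_of_centers_ne [CharZero K] (hmul : IsPAStructure g n mul)
    (hn : n.HeisenbergFrame u v c α β) {z e : V} {s : K} (hs : s ≠ 0)
    (hgz : ∀ x, g.br x z = 0) (hce : g.br c e = s • z) (hze : α z * β e - β z * α e = 1) :
    mul c c = 0 ∧ mul c z = 0 ∧ mul c e = s • z ∧ mul z c = 0 ∧ mul z z = 0 ∧
      mul z e = -(1 / 2 : K) • c ∧ mul e c = 0 ∧ mul e z = (1 / 2 : K) • c ∧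
      ∃ p q : K, mul e e = p • c + q • z := by
  have coord : ∀ y, ∃ a b d : K, y = a • c + b • z + d • e := fun y => by
    obtain ⟨γ, hγ⟩ := hn.exists_coord hze y
    exact ⟨γ, _, _, hγ.trans (by abel)⟩
  have nze : n.br z e = c := by rw [hn.br_eq, hze, one_smul]
  have indep : ∀ {a b d : K}, a • c + b • z + d • e = 0 → a = 0 ∧ b = 0 ∧ d = 0 := by
    intro a b d h
    have hα := congrArg α h
    have hβ := congrArg β h
    simp only [map_add, map_smul, hn.α_c, hn.β_c, smul_eq_mul, map_zero] at hα hβ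
    have hb : b = 0 := by
      linear_combination hα * β e - hβ * α e - b * hze
    have hd : d = 0 := by
      linear_combination hβ * α z - hα * β z - d * hze
    rw [hb, hd, zero_smul, zero_smul, add_zero, add_zero, smul_eq_zero,
      or_iff_left hn.ne_zero] at h
    exact ⟨h, hb, hd⟩
  have nez : n.br e z = -c := by rw [n.br_swap, nze]
  have nc := hn.br_center
  have cn := hn.center_br
  have gzx : ∀ x, g.br z x = 0 := fun x => by rw [g.br_swap, hgz, neg_zero]
  obtain ⟨ρ, hcc⟩ : ∃ ρ : K, mul c c = ρ • c := ⟨_, hmul.mul_center hn c⟩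
  obtain ⟨σ, hzc⟩ : ∃ σ : K, mul z c = σ • c := ⟨_, hmul.mul_center hn z⟩
  obtain ⟨τ, hec⟩ : ∃ τ : K, mul e c = τ • c := ⟨_, hmul.mul_center hn e⟩
  obtain ⟨p₁, p₂, p₃, hez⟩ := coord (mul e z)
  obtain ⟨q₁, q₂, q₃, hee⟩ := coord (mul e e)
  obtain ⟨r₁, r₂, r₃, hzz⟩ := coord (mul z z)
  have hcz : mul c z = σ • c := by
    have h := hmul.mul_sub_mul c z
    rw [hgz, cn, sub_zero, sub_eq_zero] at h
    rw [h, hzc]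
  have hce' : mul c e = τ • c + s • z := by
    have h := hmul.mul_sub_mul c e
    rw [hce, cn, hec] at h
    linear_combination (norm := module) h
  have hze' : mul z e = (p₁ - 1) • c + p₂ • z + p₃ • e := by
    have h := hmul.mul_sub_mul z e
    rw [gzx, nze, hez] at h
    linear_combination (norm := module) h
  have dc := hmul.mul_br c z e
  have dz := hmul.mul_br z z e
  have de := hmul.mul_br e z e
  rw [nze, hcc, hcz, hce'] at dc
  rw [nze, hzc, hzz, hze'] at dz
  rw [nze, hec, hez, hee] at de
  have hρ : ρ = 0 := (indep (a := ρ) (b := 0) (d := 0) (by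
    simp only [map_add, map_smul, LinearMap.smul_apply, nc, cn,
      n.br_self, smul_zero, add_zero] at dc
    rw [dc]; module)).1
  have hσ := (indep (a := σ - (r₂ + p₃)) (b := 0) (d := 0) (by
    simp only [map_add, map_smul, LinearMap.add_apply, LinearMap.smul_apply, nc, cn,
      n.br_self, nze] at dz
    linear_combination (norm := module) dz)).1
  have hτ := (indep (a := τ - (p₂ + q₃)) (b := 0) (d := 0) (by
    simp only [map_add, map_smul, LinearMap.add_apply, LinearMap.smul_apply, nc, cn,
      n.br_self, nze] at de
    linear_combination (norm := module) de)).1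
  -- As `z` is central in `g`, `L(c)` and `L(z)` commute; comparing coordinates on `e`, and then on
  -- `z`, gives `p₃² = 0`.
  have cze := hmul.br_mul c z e
  rw [hgz, hze', hce'] at cze
  simp only [map_add, map_smul, map_zero, LinearMap.zero_apply, hcc, hcz, hce', hzc, hzz] at cze
  obtain ⟨i₁, i₂, i₃⟩ := indep
    (a := (p₁ - 1) * ρ + p₂ * σ + p₃ * τ - τ * σ - s * r₁) (b := p₃ * s - s * r₂)
    (d := -(s * r₃)) (by linear_combination (norm := module) -cze)
  have hr₂ : r₂ = p₃ := mul_left_cancel₀ hs (by linear_combination -i₂)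
  have hr₃ : r₃ = 0 := mul_left_cancel₀ hs (by linear_combination -i₃)
  have czz := hmul.br_mul c z z
  rw [hgz, hzz, hcz, hr₃] at czz
  simp only [map_add, map_smul, map_zero, LinearMap.zero_apply, hcc, hcz, hce', hzc, hρ] at czz
  have j₁ := (indep (a := r₂ * σ - σ * σ) (b := 0) (d := 0)
    (by linear_combination (norm := module) -czz)).1
  have hp₃ : p₃ = 0 := by
    have : p₃ * p₃ = 0 := by
      have hσ' : σ = 2 * p₃ := by linear_combination hσ + hr₂
      rw [hσ', hr₂] at j₁
      linear_combination (-1 / 2) * j₁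
    exact mul_self_eq_zero.mp this
  have hr₂0 : r₂ = 0 := hr₂.trans hp₃
  have hσ0 : σ = 0 := by linear_combination hσ + hr₂0 + hp₃
  have hr₁ : r₁ = 0 := mul_left_cancel₀ hs (by
    rw [hρ, hσ0, hp₃] at i₁
    linear_combination -i₁)
  subst hρ hσ0 hp₃ hr₂0 hr₃ hr₁
  have zee := hmul.br_mul z e e
  rw [gzx, hze', hee] at zee
  simp only [map_add, map_smul, map_zero, LinearMap.zero_apply, hzc, hzz, hze', hec, hez] at zee
  have k₂ := (indep (a := q₃ * (p₁ - 1) - ((p₁ - 1) * τ + p₂ * p₁))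
    (b := q₃ * p₂ - p₂ * p₂) (d := 0) (by linear_combination (norm := module) -zee)).2.1
  have cee := hmul.br_mul c e e
  rw [hce, hce', hee, map_smul, LinearMap.smul_apply, hze'] at cee
  simp only [map_add, map_smul, hcc, hcz, hce', hec, hez] at cee
  obtain ⟨l₁, l₂, -⟩ := indep (a := s * (p₁ - 1) - (q₃ * τ - τ * τ - s * p₁))
    (b := s * p₂ - (q₃ * s - s * p₂)) (d := 0) (by linear_combination (norm := module) cee)
  have hq₃ : q₃ = 2 * p₂ := mul_left_cancel₀ hs (by linear_combination -l₂)
  -- Commutation of `L(z)` and `L(e)` on `e` becomes `p₂² = 0`.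
  have hp₂ : p₂ = 0 := by
    rw [hq₃] at k₂
    exact mul_self_eq_zero.mp (by linear_combination k₂)
  have hq₃0 : q₃ = 0 := by rw [hq₃, hp₂, mul_zero]
  have hτ0 : τ = 0 := by linear_combination hτ + hp₂ + hq₃0
  have hp₁ : p₁ = 1 / 2 := by
    rw [hτ0] at l₁
    apply mul_left_cancel₀ hs
    linear_combination (1 / 2) * l₁
  subst hτ0 hq₃0 hp₂ hp₁
  refine ⟨?_, ?_, ?_, ?_, ?_, ?_, ?_, ?_, q₁, q₂, ?_⟩
  · rw [hcc, zero_smul]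
  · rw [hcz, zero_smul]
  · rw [hce', zero_smul, zero_add]
  · rw [hzc, zero_smul]
  · rw [hzz]; module
  · rw [hze']; module
  · rw [hec, zero_smul]
  · rw [hez]; module
  · rw [hee]; module

theorem nilpotent_and_identities_of_centers_ne [CharZero K] (hmul : IsPAStructure g n mul)
    (hn : n.HeisenbergFrame u v c α β) {z e : V} {s : K} (hs : s ≠ 0)
    (hgz : ∀ x, g.br x z = 0) (hg : ∀ x y, ∃ k : K, g.br x y = k • z)
    (hce : g.br c e = s • z) (hze : α z * β e - β z * α e = 1) :
    (∀ x, IsNilpotent (mul x : Module.End K V)) ∧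
    (∀ x y z, mul x (n.br y z) = 0) ∧
    (∀ x y z, mul (g.br x y) z = -mul z (g.br x y)) ∧
    (∀ x y z, g.br x (mul y z) + g.br x (mul z y) = g.br y (mul x z) + g.br y (mul z x)) := by
  obtain ⟨hcc, hcz, hce', hzc, hzz, hze', hec, hez, p, q, hee⟩ :=
    hmul.mul_table_of_centers_ne hn hs hgz hce hze
  have coord : ∀ y, ∃ a b d : K, y = a • c + b • z + d • e := fun y => by
    obtain ⟨γ, hγ⟩ := hn.exists_coord hze y
    exact ⟨γ, _, _, hγ.trans (by abel)⟩
  have gzx : ∀ x, g.br z x = 0 := fun x => by rw [g.br_swap, hgz, neg_zero]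
  have gec : g.br e c = -(s • z) := by rw [g.br_swap, hce]
  have hxc : ∀ x, mul x c = 0 := fun x => by
    obtain ⟨a, b, d, rfl⟩ := coord x
    simp [hcc, hzc, hec]
  refine ⟨fun x => ⟨3, ?_⟩, fun x y w => ?_, fun x y w => ?_, fun x y w => ?_⟩
  -- Every `L(x)` lowers the flag `V ⊃ ⟨c, z⟩ ⊃ ⟨c⟩ ⊃ 0`.
  · ext y
    obtain ⟨a, b, d, rfl⟩ := coord x
    obtain ⟨a', b', d', rfl⟩ := coord y
    change mul _ (mul _ (mul _ _)) = 0
    simp [hcc, hcz, hce', hzc, hzz, hze', hec, hez, hee]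
  · rw [hn.br_eq, map_smul, hxc, smul_zero]
  · obtain ⟨k, hk⟩ := hg x y
    obtain ⟨a, b, d, rfl⟩ := coord w
    rw [hk]
    simp [hcz, hzc, hzz, hze', hez]
  · obtain ⟨a, b, d, rfl⟩ := coord x
    obtain ⟨a', b', d', rfl⟩ := coord y
    obtain ⟨a₂, b₂, d₂, rfl⟩ := coord w
    simp only [map_add, map_smul, LinearMap.add_apply, LinearMap.smul_apply, hcc, hcz, hce', hzc,
      hzz, hze', hec, hez, hee, hgz, gzx, gec, g.br_self,
      smul_zero, add_zero, zero_add]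
    module

/-! ### Combining the two cases -/

theorem nilpotent_and_identities [CharZero K] (hmul : IsPAStructure g n mul)
    (hn : n.HeisenbergFrame u v c α β) {u' v' z : V} {α' β' : V →ₗ[K] K}
    (hg : g.HeisenbergFrame u' v' z α' β') :
    (∀ x, IsNilpotent (mul x : Module.End K V)) ∧
    (∀ x y z, mul x (n.br y z) = 0) ∧
    (∀ x y z, mul (g.br x y) z = -mul z (g.br x y)) ∧
    (∀ x y z, g.br x (mul y z) + g.br x (mul z y) = g.br y (mul x z) + g.br y (mul z x)) := by
  by_cases h : α z = 0 ∧ β z = 0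
  · obtain ⟨k, hk⟩ := hn.eq_smul_center h.1 h.2
    have hk0 : k ≠ 0 := fun hk0 => hg.ne_zero (by rw [hk, hk0, zero_smul])
    have gxc : ∀ x, g.br x c = 0 := fun x => by
      have h := hg.br_center x
      rwa [hk, map_smul, smul_eq_zero, or_iff_right hk0] at h
    have gcx : ∀ x, g.br c x = 0 := fun x => by rw [g.br_swap, gxc, neg_zero]
    obtain ⟨r, hr⟩ : ∃ r : K, g.br u v = r • c :=
      ⟨_, by rw [hg.br_eq, hk, smul_smul]⟩
    have hgn : ∀ x y, g.br x y = r • n.br x y := by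
      intro x y
      obtain ⟨a, ha⟩ := hn.exists_eq x
      obtain ⟨b, hb⟩ := hn.exists_eq y
      rw [hn.br_eq]
      conv_lhs => rw [ha, hb]
      simp only [map_add, map_smul, LinearMap.add_apply, LinearMap.smul_apply, gxc, gcx,
        g.br_self, g.br_swap v u, hr]
      module
    refine hmul.nilpotent_and_identities_of_eq_smul hn (r := r) ?_ hgn
    rintro rfl
    apply hg.ne_zero
    rw [← hg.br_u_v, hgn, zero_smul]
  · obtain ⟨e, he⟩ : ∃ e, α z * β e - β z * α e = 1 := by
      by_cases hα : α z = 0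
      · have hβ : β z ≠ 0 := fun hβ => h ⟨hα, hβ⟩
        exact ⟨-(β z)⁻¹ • u, by simp [hα, hn.α_u, hβ]⟩
      · exact ⟨(α z)⁻¹ • v, by simp [hn.α_v, hn.β_v, hα]⟩
    have hgz := hg.br_center
    obtain ⟨s, hs⟩ : ∃ s : K, g.br c e = s • z := ⟨_, hg.br_eq c e⟩
    refine hmul.nilpotent_and_identities_of_centers_ne hn ?_ hgz (fun x y => ⟨_, hg.br_eq x y⟩)
      hs he
    -- If `s = 0`, then `g` vanishes on the basis `c, z, e`, contradicting `[u', v'] = z ≠ 0`.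
    rintro rfl
    rw [zero_smul] at hs
    apply hg.ne_zero
    obtain ⟨a, ha⟩ := hn.exists_coord he u'
    obtain ⟨b, hb⟩ := hn.exists_coord he v'
    rw [← hg.br_u_v, ha, hb]
    simp [hgz, hg.center_br, hs, g.br_swap e c, g.br_self]

end IsPAStructure

theorem corollary5p3 {K V : Type*} [Field K] [CharZero K] [AddCommGroup V] [Module K V]
    (g n : LieBracket K V) (hg : g.IsHeisenberg) (hn : n.IsHeisenberg)
    (mul : V →ₗ[K] V →ₗ[K] V) (hmul : IsPAStructure g n mul) :
    (∀ x, IsNilpotent (mul x : Module.End K V)) ∧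
    (∀ x y z, mul x (n.br y z) = 0) ∧
    (∀ x y z, mul (g.br x y) z = -mul z (g.br x y)) ∧
    (∀ x y z, g.br x (mul y z) + g.br x (mul z y) = g.br y (mul x z) + g.br y (mul z x)) ∧
    IsCPAStructure g (symmProduct mul) := by
  obtain ⟨u, v, c, α, β, hn⟩ := hn.exists_frame
  obtain ⟨u', v', z, α', β', hg⟩ := hg.exists_frame
  obtain ⟨h₀, h₁, h₂, h₃⟩ := hmul.nilpotent_and_identities hn hg
  exact ⟨h₀, h₁, h₂, h₃, hmul.isCPAStructure_symmProduct hg.br_br hn.br_br h₁ h₂ h₃⟩
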